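/- Let $d\ge 2$, and write $[n]=\{1,\dots,n\}$. A real $(d+1)\times(d+1)$ matrix $A=[a_{i,j}]$ is *normal idempotent* (NI) if $a_{i,i}=0$ and $a_{i,j}\le 0$ for all $i,j$, and $\max_j (a_{i,j}+a_{j,k})=a_{i,k}$ for all $i,k$. Put $$\mathcal P(A)=\{x\in\mathbb R^d:\ a_{i,j}\le x_i-x_j\le -a_{j,i}\ \text{ for all } i,j\in[d+1]\},\qquad x_{d+1}:=0.$$ Suppose that $A$ is NI and that $\mathcal P(A)$ is a $d$-dimensional *isocanted alcoved polytope* ($d$-IAP). This means that $A=B-E$, where - $B=[b_{i,j}]$ is an NI box matrix: for some edge-lengths $\ell_1,\dots,\ell_d>0$ and reals $c_1,\dots,c_d$, with $c_{d+1}=0$, one has $b_{i,j}=c_i-\ell_i-c_j$ if $d+1\ne i\ne j$, and $b_{i,j}=c_i-c_j$ otherwise; - $E=[e_{i,j}]$ has zero diagonal, zero last row and zero last column, and $e_{i,j}=-a$ for all $i\neq j$ in $[d]$, where the cant parameter $a$ satisfies $0<a<\min_i \ell_i$. For $\emptyset\ne W\subsetneq[d+1]$ let $L_A(W)\subset\mathbb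 R^d$ be the tropical (max-plus) linear subspace determined by the columns indexed by $W$ of the matrix $A_0=[a_{i,j}-a_{d+1,j}]$. That is, $L_A(W)$ is the set of those $x$ (with $x_{d+1}=0$) such that for every $\tau\subseteq[d+1]$ with $|\tau|=|W|+1$ the maximum over $k\in\tau$ of $x_k+m_{\tau\setminus\{k\}}$ is attained at least twice, where $m_\sigma$ is the maximum over all bijections $f:\sigma\to W$ of $\sum_{i\in\sigma}(A_0)_{i,f(i)}$. A *vertex* of $L_A(W)$ is a point $x \in L_A(W)$ such that there is no nonzero direction along which $L_A(W)$ is translation invariant in a neighbourhood of $x$. Then each $L_A(W)$ has a unique vertex $\underline W$, and $W\mapsto\underline W$ is a bijection from the nonempty proper subsets of $[d+1]$ onto the vertices of $\mathcal P(A)$ ($\underline W$ is the vertex *labelled* $W$). In the graph (1-skeleton) of $\mathcal P(A)$, whose edges are the one-dimensional faces of $\mathcal P(A)$, the distance between the vertices labelled $W$ and $W'$ is $|W\,\triangle\,W'|$ for all nonempty proper subsets $W,W'$ of $[d+1]$, and the diameter of the graph is $d+1$. -/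

import Mathlib

open scoped Topology

namespace IAP

/-- `x = (x₁, …, x_d)` followed by `x_{d+1} = 0`; the index `d + 1` is `Fin.last d`. This identifies
`ℝ^d` with the hyperplane `x_{d+1} = 0` of `ℝ^{d+1}`. -/
def homog {d : ℕ} (x : Fin d → ℝ) : Fin (d + 1) → ℝ :=
  Fin.snoc (α := fun _ => ℝ) x 0

/-- The product of two matrices over the max-plus semiring. -/
noncomputable def tropMul {d : ℕ} (A B : Matrix (Fin (d + 1)) (Fin (d + 1)) ℝ) :
    Matrix (Fin (d + 1)) (Fin (d + 1)) ℝ :=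
  fun i k => Finset.univ.sup' Finset.univ_nonempty fun j => A i j + B j k

/-- Normal idempotent (NI) matrices: null diagonal, nonpositive entries, and `A ⊙ A = A`. -/
def IsNormalIdempotent {d : ℕ} (A : Matrix (Fin (d + 1)) (Fin (d + 1)) ℝ) : Prop :=
  (∀ i, A i i = 0) ∧ (∀ i j, A i j ≤ 0) ∧ tropMul A A = A

/-- The set `P(A) ⊆ ℝ^d` given by `a_{ij} ≤ x_i - x_j ≤ -a_{ji}` for `i, j ∈ [d + 1]`, with the
convention `x_{d+1} = 0`, so that `j = d + 1` gives `a_{i,d+1} ≤ x_i ≤ -a_{d+1,i}`. -/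
def alcoved {d : ℕ} (A : Matrix (Fin (d + 1)) (Fin (d + 1)) ℝ) : Set (Fin d → ℝ) :=
  {x | ∀ i j, A i j ≤ homog x i - homog x j ∧ homog x i - homog x j ≤ -A j i}

/-- The visualized box matrix with edge-lengths `ℓ`: the entry `(i, j)` is `-ℓ_i` if
`d + 1 ≠ i ≠ j`, and `0` otherwise. -/
def boxVNI {d : ℕ} (ℓ : Fin d → ℝ) : Matrix (Fin (d + 1)) (Fin (d + 1)) ℝ :=
  fun i j => if i = j then 0 else homog (fun k => -ℓ k) i

/-- Box matrices with edge-lengths `ℓ`: the conjugates `D ⊙ B ⊙ D⁻¹` of the visualized box matrix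
`B` by a diagonal matrix `D = diag(c₁, …, c_d, 0)`. -/
def IsBoxMatrix {d : ℕ} (ℓ : Fin d → ℝ) (B : Matrix (Fin (d + 1)) (Fin (d + 1)) ℝ) : Prop :=
  (∀ i, 0 < ℓ i) ∧ ∃ c : Fin d → ℝ, ∀ i j, B i j = homog c i + boxVNI ℓ i j - homog c j

/-- Perturbation matrices: nonpositive, with null diagonal, last row and last column. -/
def IsPerturbation {d : ℕ} (E : Matrix (Fin (d + 1)) (Fin (d + 1)) ℝ) : Prop :=
  (∀ i j, E i j ≤ 0) ∧ (∀ i, E i i = 0) ∧ (∀ i, E (Fin.last d) i = 0) ∧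
    ∀ i, E i (Fin.last d) = 0

/-- The NI matrix `A` defines an isocanted alcoved polytope `P(A)`: in the decomposition `A = B - E`
into an NI box matrix `B` and a perturbation matrix `E`, the entries `e_{ij}` with `i ≠ j` in `[d]`
are all equal to `-a`, where the cant parameter `a` is positive and less than every edge-length of
the bounding box. -/
def IsIsocanted {d : ℕ} (A : Matrix (Fin (d + 1)) (Fin (d + 1)) ℝ) : Prop :=
  IsNormalIdempotent A ∧
    ∃ (ℓ : Fin d → ℝ) (B E : Matrix (Fin (d + 1)) (Fin (d + 1)) ℝ) (a : ℝ),
      A = B - E ∧ IsNormalIdempotent B ∧ IsBoxMatrix ℓ B ∧ IsPerturbation E ∧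
      (∀ i j : Fin d, i ≠ j → E i.castSucc j.castSucc = -a) ∧
      0 < a ∧ ∀ i, a < ℓ i

/-- The graph (1-skeleton) of a polytope `P`: its vertices are the extreme points of `P`, and two
of them are adjacent when the segment joining them is a face of `P`. -/
def skeleton {d : ℕ} (P : Set (Fin d → ℝ)) : SimpleGraph (P.extremePoints ℝ) where
  Adj u v := u ≠ v ∧ IsExtreme ℝ P (segment ℝ (u : Fin d → ℝ) v)
  symm := ⟨fun u v h => ⟨h.1.symm, by rw [segment_symm]; exact h.2⟩⟩
  loopless := ⟨fun _ h => h.1 rfl⟩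

/-- The matrix `A₀`, with entries `a_{ij} - a_{d+1,j}`. Its columns are the generators of `P(A)`. -/
def auxMatrix {d : ℕ} (A : Matrix (Fin (d + 1)) (Fin (d + 1)) ℝ) :
    Matrix (Fin (d + 1)) (Fin (d + 1)) ℝ :=
  fun i j => A i j - A (Fin.last d) j

/-- The tropical minor (max-plus permanent) of `A` with row set `σ` and column set `W`; used only
for `σ` and `W` of the same cardinality. -/
noncomputable def tropMinor {d : ℕ} (A : Matrix (Fin (d + 1)) (Fin (d + 1)) ℝ)
    (σ W : Finset (Fin (d + 1))) : ℝ :=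
  ⨆ f : {i // i ∈ σ} ≃ {j // j ∈ W}, ∑ i : {i // i ∈ σ}, A i.1 (f i).1

/-- The tropical linear subspace `L_A(W)` determined by the columns of `A₀` indexed by `W`, in the
hyperplane `x_{d+1} = 0`, through its tropical Plücker coordinates (the maximal tropical minors of
those columns): for every row set `τ` of size `|W| + 1`, the maximum over `k ∈ τ` of
`x_k + minor (τ \ {k}, W)` is attained at least twice. -/
def tropSpan {d : ℕ} (A : Matrix (Fin (d + 1)) (Fin (d + 1)) ℝ) (W : Finset (Fin (d + 1))) :
    Set (Fin d → ℝ) :=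
  {x | ∀ τ : Finset (Fin (d + 1)), τ.card = W.card + 1 →
    ∃ k ∈ τ, ∃ k' ∈ τ, k ≠ k' ∧
      homog x k + tropMinor (auxMatrix A) (τ.erase k) W =
        homog x k' + tropMinor (auxMatrix A) (τ.erase k') W ∧
      ∀ i ∈ τ, homog x i + tropMinor (auxMatrix A) (τ.erase i) W ≤
        homog x k + tropMinor (auxMatrix A) (τ.erase k) W}

/-- `x` is a vertex of the set `S`, a finite union of polyhedra with its coarsest polyhedral
structure: `x ∈ S`, and there is no direction `v ≠ 0` along which `S` is invariant near `x`. -/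
def IsComplexVertex {d : ℕ} (S : Set (Fin d → ℝ)) (x : Fin d → ℝ) : Prop :=
  x ∈ S ∧ ∀ v : Fin d → ℝ,
    (∃ U ∈ 𝓝 x, ∀ y ∈ U, ∀ t : ℝ, y + t • v ∈ U → (y ∈ S ↔ y + t • v ∈ S)) → v = 0

/-- The possible labels: proper subsets of `[d + 1]`, i.e. neither empty nor everything. -/
abbrev Label (d : ℕ) : Type :=
  {W : Finset (Fin (d + 1)) // W.Nonempty ∧ W ≠ Finset.univ}

/-- `W ↦ label W` is the labelling of the vertices of `P(A)` by the proper subsets of `[d + 1]`: it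
is a bijection, and the vertex labelled `W` is the unique vertex of `L_A(W)`. -/
def IsLabelling {d : ℕ} (A : Matrix (Fin (d + 1)) (Fin (d + 1)) ℝ)
    (label : Label d → (alcoved A).extremePoints ℝ) : Prop :=
  Function.Bijective label ∧
    ∀ (W : Label d) (x : Fin d → ℝ),
      IsComplexVertex (tropSpan A W.1) x ↔ x = (label W : Fin d → ℝ)

end IAP

/-! ### Homogeneous coordinates and the cube normal form -/

namespace IAP

/-! The isocanted condition amounts to `A i j = p i - p j - lam j` off the diagonal with all `lam j`
positive. In coordinates relative to `p`, the inequalities of `alcoved A` read `x_j - x_i ≤ lam j`;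
shifting the least coordinate to 0 shows that the polytope is the projection of the
(d+1)-dimensional box `p + ∏ [0, lam i]` along the all-ones vector. The box vertices `∅` and `univ`
project into the interior, and the others project to distinct extreme points.

The same form makes the tropical minors explicit. After a translation depending on `W`, `tropSpan A
W` is the tropical linear space of a uniform matroid, a fan whose only vertex is its apex
(`mem_tropSpan_iff`). The apex is the projected box vertex `vtx p lam W`, so the prescribed
labelling is the one inherited from the box.

Edges are exactly the projected box edges avoiding `∅` and `univ`: an edge of the box is cut out by
tight inequalities (`isExtreme_segment_insert`), while a longer jump fails because its midpoint is
also the midpoint of another pair of projected vertices (`vtx_symmDiff_mem_segment`). Distance is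
then Hamming distance, since for `d ≥ 2` a shortest path can avoid the two missing vertices
(`Label.exists_step`). Complementary labels realise the diameter. -/

/-- The projection of `ℝ^{d+1}` onto the hyperplane `x_{d+1} = 0` along the vector of ones. -/
def dehomog {d : ℕ} (w : Fin (d + 1) → ℝ) : Fin d → ℝ :=
  fun i => w i.castSucc - w (Fin.last d)

@[simp] theorem homog_last {d : ℕ} (x : Fin d → ℝ) : homog x (Fin.last d) = 0 := by
  simp [homog]

@[simp] theorem homog_castSucc {d : ℕ} (x : Fin d → ℝ) (i : Fin d) :
    homog x i.castSucc = x i := by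
  simp [homog]

theorem homog_add {d : ℕ} (x y : Fin d → ℝ) (i : Fin (d + 1)) :
    homog (x + y) i = homog x i + homog y i := by
  refine Fin.lastCases ?_ (fun i => ?_) i <;> simp

theorem homog_smul {d : ℕ} (t : ℝ) (x : Fin d → ℝ) (i : Fin (d + 1)) :
    homog (t • x) i = t * homog x i := by
  refine Fin.lastCases ?_ (fun i => ?_) i <;> simp

theorem homog_dehomog {d : ℕ} (w : Fin (d + 1) → ℝ) (i : Fin (d + 1)) :
    homog (dehomog w) i = w i - w (Fin.last d) := by
  refine Fin.lastCases ?_ (fun i => ?_) i <;> simp [dehomog]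

theorem continuous_homog {d : ℕ} (i : Fin (d + 1)) :
    Continuous fun x : Fin d → ℝ => homog x i := by
  refine Fin.lastCases ?_ (fun i => ?_) i
  · simpa using continuous_const
  · simpa using continuous_apply i

theorem eq_dehomog_iff {d : ℕ} {x : Fin d → ℝ} {w : Fin (d + 1) → ℝ} :
    x = dehomog w ↔ ∀ i j, homog x i - homog x j = w i - w j := by
  constructor
  · rintro rfl i j
    rw [homog_dehomog, homog_dehomog]
    ring
  · intro h
    funext i
    simpa [dehomog] using h i.castSucc (Fin.last d)

/-- The contribution of the label `W` in the direction `i`: the sides of the cube `∏ [0, lam i]`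
taken at its vertex `W`. -/
noncomputable def side {d : ℕ} (lam : Fin (d + 1) → ℝ) (W : Finset (Fin (d + 1)))
    (i : Fin (d + 1)) : ℝ :=
  if i ∈ W then lam i else 0

theorem side_of_mem {d : ℕ} {lam : Fin (d + 1) → ℝ} {W : Finset (Fin (d + 1))}
    {i : Fin (d + 1)} (h : i ∈ W) : side lam W i = lam i := if_pos h

theorem side_of_notMem {d : ℕ} {lam : Fin (d + 1) → ℝ} {W : Finset (Fin (d + 1))}
    {i : Fin (d + 1)} (h : i ∉ W) : side lam W i = 0 := if_neg h

/-- The projection of the vertex `W` of the cube `p + ∏ [0, lam i]`. -/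
noncomputable def vtx {d : ℕ} (p lam : Fin (d + 1) → ℝ) (W : Finset (Fin (d + 1))) :
    Fin d → ℝ :=
  dehomog fun i => p i + side lam W i

/-- The matrices whose alcoved polytope is the projection of the cube `p + ∏ [0, lam i]`. -/
structure IsCubeMatrix {d : ℕ} (A : Matrix (Fin (d + 1)) (Fin (d + 1)) ℝ)
    (p lam : Fin (d + 1) → ℝ) : Prop where
  pos : ∀ i, 0 < lam i
  apply : ∀ i j, A i j = p i - p j - if i = j then 0 else lam j

theorem IsIsocanted.exists_isCubeMatrix {d : ℕ} {A : Matrix (Fin (d + 1)) (Fin (d + 1)) ℝ}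
    (hA : IsIsocanted A) : ∃ p lam, IsCubeMatrix A p lam := by
  obtain ⟨-, ℓ, B, E, a, rfl, -, ⟨-, c, hB⟩, ⟨-, hE, hEl, hEr⟩, ha, ha0, hal⟩ := hA
  -- The vector `p` is the lower corner `c - ℓ` of the bounding box, extended by `-a`. The cant
  -- gives the side in the extra direction, and `0 < a < ℓ i` makes every side positive.
  refine ⟨Fin.snoc (α := fun _ => ℝ) (fun i => c i - ℓ i) (-a),
    Fin.snoc (α := fun _ => ℝ) (fun i => ℓ i - a) a, ⟨fun i => ?_, fun i j => ?_⟩⟩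
  · refine Fin.lastCases ?_ (fun i => ?_) i
    · simpa using ha0
    · simpa using hal i
  · rw [Matrix.sub_apply, hB, boxVNI]
    by_cases hij : i = j
    · subst hij
      simp [hE]
    · rw [if_neg hij, if_neg hij]
      induction i using Fin.lastCases with
      | last =>
        induction j using Fin.lastCases with
        | last => exact absurd rfl hij
        | cast j => simp [hEl]; ring
      | cast i =>
        induction j using Fin.lastCases with
        | last => simp [hEr]; ring
        | cast j =>
          rw [ha i j (fun h => hij (h ▸ rfl))]
          simp
          ring

/-! ### Tropical minors and the vertex of each tropical linear space -/

section minors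

variable {d : ℕ} {A : Matrix (Fin (d + 1)) (Fin (d + 1)) ℝ} {p lam : Fin (d + 1) → ℝ}

theorem IsCubeMatrix.auxMatrix_apply (h : IsCubeMatrix A p lam) (i j : Fin (d + 1)) :
    auxMatrix A i j =
      p i + (if i = j then lam j else 0) + (-p j - lam j - A (Fin.last d) j) := by
  rw [auxMatrix, h.apply i j]
  split_ifs <;> ring

/-- Up to row and column constants, the matrix is diagonal with positive entries `lam`. An optimal
bijection therefore fixes every index of `σ ∩ W`. -/
theorem IsCubeMatrix.tropMinor_eq (h : IsCubeMatrix A p lam) {σ W : Finset (Fin (d + 1))}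
    (hc : σ.card = W.card) :
    tropMinor (auxMatrix A) σ W = ∑ i ∈ σ, (p i + side lam W i) +
      ∑ j ∈ W, (-p j - lam j - A (Fin.last d) j) := by
  have key (f : {i // i ∈ σ} ≃ {j // j ∈ W}) :
      ∑ i : {i // i ∈ σ}, auxMatrix A i.1 (f i).1 =
        ∑ i : {i // i ∈ σ}, (p i.1 + if i.1 = (f i).1 then lam (f i).1 else 0) +
          ∑ j ∈ W, (-p j - lam j - A (Fin.last d) j) := by
    simp only [h.auxMatrix_apply, Finset.sum_add_distrib (f := fun i : {i // i ∈ σ} =>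
      (p i.1 + if i.1 = (f i).1 then lam (f i).1 else 0))]
    congr 1
    rw [f.sum_comp (fun j : {j // j ∈ W} => -p j.1 - lam j.1 - A (Fin.last d) j.1),
      ← Finset.sum_coe_sort W]
  -- An optimal bijection: the identity on `σ ∩ W`, extended arbitrarily.
  obtain ⟨g, hg⟩ := Finset.exists_equiv_extend_of_card_eq (α := {i // i ∈ σ}) (t := W)
    (by simpa using hc) (s := Finset.univ.filter fun i => i.1 ∈ W) (f := Subtype.val)
    (by intro x; simpa using fun h _ => h) Subtype.val_injective.injOn
  have hne : Nonempty ({i // i ∈ σ} ≃ {j // j ∈ W}) := ⟨g⟩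
  rw [tropMinor]
  refine le_antisymm (ciSup_le fun f => ?_) ((le_of_eq ?_).trans
    (le_ciSup (Set.finite_range _).bddAbove g))
  · rw [key f, ← Finset.sum_coe_sort σ]
    gcongr with i
    split_ifs with hi
    · rw [hi, side_of_mem (f i).2]
    · rw [side]
      split_ifs
      exacts [(h.pos _).le, le_rfl]
  · rw [key g, ← Finset.sum_coe_sort σ]
    congr 1
    refine Finset.sum_congr rfl fun i _ => ?_
    by_cases hi : i.1 ∈ W
    · rw [hg i (by simpa using hi), if_pos rfl, side_of_mem hi]
    · rw [side_of_notMem hi, if_neg fun hgi : i.1 = (g i).1 => hi (hgi.symm ▸ (g i).2)]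

/-- Coordinates in which `tropSpan A W` is the tropical linear space of a uniform matroid. -/
noncomputable def centered (p lam : Fin (d + 1) → ℝ) (W : Finset (Fin (d + 1)))
    (x : Fin d → ℝ) (i : Fin (d + 1)) : ℝ :=
  homog x i - p i - side lam W i

/-- By the minor formula, the terms for `τ` are the centered coordinates plus a constant depending
only on `τ`. A maximum attained only once, at `k`, means `|W|` indices lying strictly below `k`. -/
theorem IsCubeMatrix.mem_tropSpan_iff (h : IsCubeMatrix A p lam) {W : Finset (Fin (d + 1))}
    {x : Fin d → ℝ} : x ∈ tropSpan A W ↔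
      ∀ k, (Finset.univ.filter fun i => centered p lam W x i < centered p lam W x k).card <
        W.card := by
  set u := centered p lam W x with hu
  have key (τ : Finset (Fin (d + 1))) (hτ : τ.card = W.card + 1) : ∃ C, ∀ k ∈ τ,
      homog x k + tropMinor (auxMatrix A) (τ.erase k) W = C + u k := by
    refine ⟨∑ i ∈ τ, (p i + side lam W i) + ∑ j ∈ W, (-p j - lam j - A (Fin.last d) j),
      fun k hk => ?_⟩
    rw [h.tropMinor_eq (by rw [Finset.card_erase_of_mem hk, hτ, Nat.add_sub_cancel]),
      ← Finset.add_sum_erase τ _ hk, hu, centered]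
    ring
  constructor
  · intro hx k
    by_contra! hk
    obtain ⟨T, hT, hTc⟩ := Finset.exists_subset_card_eq hk
    have hkT : k ∉ T := fun hkT => by simpa using hT hkT
    have hlt : ∀ i ∈ T, u i < u k := fun i hi => by simpa using hT hi
    have hc : (insert k T).card = W.card + 1 := by rw [Finset.card_insert_of_notMem hkT, hTc]
    obtain ⟨C, hC⟩ := key _ hc
    obtain ⟨m, hm, m', hm', hne, heq, hle⟩ := hx _ hc
    rw [hC m hm, hC m' hm'] at heq
    have h1 := hle k (Finset.mem_insert_self k T)
    rw [hC m hm, hC k (Finset.mem_insert_self k T)] at h1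
    rcases Finset.mem_insert.1 hm with rfl | hmT
    · rcases Finset.mem_insert.1 hm' with rfl | hmT'
      · exact hne rfl
      · linarith [hlt _ hmT']
    · linarith [hlt _ hmT]
  · intro hx τ hτ
    obtain ⟨C, hC⟩ := key τ hτ
    obtain ⟨k, hk, hmax⟩ := τ.exists_max_image u (Finset.card_pos.1 (by omega))
    have : ∃ k' ∈ τ.erase k, u k ≤ u k' := by
      by_contra! hcon
      have hsub : τ.erase k ⊆ Finset.univ.filter fun i => u i < u k := fun i hi => by
        simpa using hcon i hi
      have := (Finset.card_le_card hsub).trans_lt (hx k)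
      rw [Finset.card_erase_of_mem hk] at this
      omega
    obtain ⟨k', hk', hle⟩ := this
    have hk'τ := Finset.mem_of_mem_erase hk'
    refine ⟨k, hk, k', hk'τ, (Finset.ne_of_mem_erase hk').symm, ?_, fun i hi => ?_⟩
    · rw [hC k hk, hC k' hk'τ, le_antisymm hle (hmax k' hk'τ)]
    · rw [hC k hk, hC i hi]
      linarith [hmax i hi]

theorem centered_add_smul (W : Finset (Fin (d + 1))) (x v : Fin d → ℝ) (t : ℝ)
    (i : Fin (d + 1)) :
    centered p lam W (x + t • v) i = centered p lam W x i + t * homog v i := by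
  rw [centered, centered, homog_add, homog_smul]
  ring

theorem continuous_centered (W : Finset (Fin (d + 1))) (i : Fin (d + 1)) :
    Continuous fun x => centered p lam W x i :=
  ((continuous_homog i).sub continuous_const).sub continuous_const

theorem forall_centered_eq_iff {W : Finset (Fin (d + 1))} {x : Fin d → ℝ} :
    (∀ k l, centered p lam W x k = centered p lam W x l) ↔ x = vtx p lam W := by
  rw [vtx, eq_dehomog_iff]
  refine forall₂_congr fun k l => ?_
  rw [centered, centered]
  constructor <;> intro h <;> linarith

/-- A point with a non-maximal coordinate `k` can be moved along that coordinate. -/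
theorem IsCubeMatrix.mem_tropSpan_add_smul (h : IsCubeMatrix A p lam)
    {W : Finset (Fin (d + 1))} {k l : Fin (d + 1)} (hkl : k ≠ l) {y : Fin d → ℝ} {t : ℝ}
    (hy : centered p lam W y k < centered p lam W y l)
    (hy' : centered p lam W (y + t • dehomog (Pi.single k 1)) k <
      centered p lam W (y + t • dehomog (Pi.single k 1)) l)
    (hmem : y ∈ tropSpan A W) : y + t • dehomog (Pi.single k 1) ∈ tropSpan A W := by
  rw [h.mem_tropSpan_iff] at hmem ⊢
  intro m
  -- The count is largest at a maximal coordinate `M`. Since `M ≠ k`, moving `k` adds no index to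
  -- those below `M`.
  obtain ⟨M, -, hM⟩ := Finset.univ.exists_max_image
    (centered p lam W (y + t • dehomog (Pi.single k 1))) Finset.univ_nonempty
  have hMl := hM l (Finset.mem_univ l)
  have hMk : M ≠ k := by
    rintro rfl
    linarith
  refine (Finset.card_le_card fun i hi => ?_).trans_lt (hmem M)
  simp only [Finset.mem_filter, Finset.mem_univ, true_and] at hi ⊢
  replace hi := hi.trans_le (hM m (Finset.mem_univ m))
  simp only [centered_add_smul, homog_dehomog, Pi.single_apply, if_neg hMk,
    if_neg hkl.symm] at hi hMl
  by_cases hik : i = k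
  · subst hik
    linarith
  · rw [if_neg hik] at hi
    linarith

/-- If the centered coordinates are not all equal, a non-maximal one can be moved freely, which is a
direction of local invariance. -/
theorem IsCubeMatrix.eq_vtx_of_isComplexVertex (h : IsCubeMatrix A p lam)
    {W : Finset (Fin (d + 1))} {x : Fin d → ℝ} (hx : IsComplexVertex (tropSpan A W) x) :
    x = vtx p lam W := by
  rw [← forall_centered_eq_iff]
  by_contra! hcon
  obtain ⟨k, l, hlt⟩ : ∃ k l, centered p lam W x k < centered p lam W x l := by
    obtain ⟨k, l, hne⟩ := hcon
    rcases hne.lt_or_gt with hlt | hlt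
    exacts [⟨k, l, hlt⟩, ⟨l, k, hlt⟩]
  have hkl : k ≠ l := by
    rintro rfl
    exact hlt.false
  have hv := hx.2 (dehomog (Pi.single k 1))
    ⟨{y | centered p lam W y k < centered p lam W y l},
      (isOpen_lt (continuous_centered W k) (continuous_centered W l)).mem_nhds hlt, ?_⟩
  · have h1 := homog_dehomog (Pi.single k (1 : ℝ)) k
    have h2 := homog_dehomog (Pi.single k (1 : ℝ)) l
    have h3 (i) : homog (0 : Fin d → ℝ) i = 0 := by
      refine Fin.lastCases ?_ (fun i => ?_) i <;> simp
    rw [hv, h3, Pi.single_eq_same] at h1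
    rw [hv, h3, Pi.single_eq_of_ne hkl.symm] at h2
    linarith
  · intro y hy t hy'
    refine ⟨h.mem_tropSpan_add_smul hkl hy hy', fun hmem => ?_⟩
    have hback : y + t • dehomog (Pi.single k (1 : ℝ)) + (-t) • dehomog (Pi.single k 1) = y := by
      rw [neg_smul, add_neg_cancel_right]
    have := h.mem_tropSpan_add_smul (t := -t) hkl hy' (by rwa [hback]) hmem
    rwa [hback] at this

/-- At the apex, any `v ≠ 0` separates some coordinate `j` from the last one. Lowering `|W| - 1`
other coordinates gives a nearby point of the space where a small step along `v` puts one index too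
many below another. -/
theorem IsCubeMatrix.isComplexVertex_vtx (h : IsCubeMatrix A p lam)
    {W : Finset (Fin (d + 1))} (hW : W.Nonempty) (hW' : W ≠ Finset.univ) :
    IsComplexVertex (tropSpan A W) (vtx p lam W) := by
  have hconst := forall_centered_eq_iff.2 (rfl : vtx p lam W = vtx p lam W)
  refine ⟨h.mem_tropSpan_iff.2 fun k => ?_, ?_⟩
  · simp [hconst _ k, hW]
  rintro v ⟨U, hU, hinv⟩
  by_contra hv
  obtain ⟨j, hj⟩ : ∃ j, v j ≠ 0 := by
    by_contra! hcon
    exact hv (funext hcon)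
  have hWlt : W.card < d + 1 := by
    simpa using (Finset.card_lt_iff_ne_univ W).2 hW'
  have hjl : j.castSucc ≠ Fin.last d := (Fin.castSucc_lt_last j).ne
  obtain ⟨I, hI, hIc⟩ := Finset.exists_subset_card_eq
    (s := (Finset.univ.erase j.castSucc).erase (Fin.last d)) (n := W.card - 1) (by
      rw [Finset.card_erase_of_mem (by simp [hjl.symm]),
        Finset.card_erase_of_mem (Finset.mem_univ _), Finset.card_univ, Fintype.card_fin]
      omega)
  have hjI : j.castSucc ∉ I := fun hm => by simpa using hI hm
  have hlI : Fin.last d ∉ I := fun hm => by simpa using hI hm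
  have hpos := hW.card_pos
  -- `δ` is small enough that the step along `v` cannot undo the unit drop on `I`.
  obtain ⟨δ, hδ, hδv⟩ : ∃ δ : ℝ, 0 < δ ∧ ∀ i, δ * homog v i < 1 := by
    refine ⟨(‖v‖ + 1)⁻¹, by positivity, fun i => ?_⟩
    rw [inv_mul_lt_one₀ (by positivity)]
    refine Fin.lastCases ?_ (fun i => ?_) i
    · rw [homog_last]
      positivity
    · rw [homog_castSucc]
      linarith [le_abs_self (v i), norm_le_pi_norm v i, Real.norm_eq_abs (v i)]
  set e : Fin d → ℝ := dehomog fun i => if i ∈ I then -1 else 0 with he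
  have hei (i) : homog e i = if i ∈ I then -1 else 0 := by
    rw [he, homog_dehomog, if_neg hlI, sub_zero]
  have hcont (b : Fin d → ℝ) :
      Filter.Tendsto (fun ε : ℝ => vtx p lam W + ε • b) (𝓝[>] 0) (𝓝 (vtx p lam W)) := by
    have : Continuous fun ε : ℝ => vtx p lam W + ε • b := by fun_prop
    simpa using (this.tendsto 0).mono_left nhdsWithin_le_nhds
  obtain ⟨ε, hε, hε1, hε2⟩ : ∃ ε : ℝ, 0 < ε ∧ vtx p lam W + ε • e ∈ U ∧
      vtx p lam W + ε • (e + δ • v) ∈ U :=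
    (eventually_mem_nhdsWithin.and
      (((hcont e).eventually_mem hU).and ((hcont (e + δ • v)).eventually_mem hU))).exists
  have hsplit : vtx p lam W + ε • (e + δ • v) = vtx p lam W + ε • e + (ε * δ) • v := by
    rw [smul_add, smul_smul, add_assoc]
  have hmem : vtx p lam W + ε • e ∈ tropSpan A W := by
    refine h.mem_tropSpan_iff.2 fun k => ?_
    refine (Finset.card_le_card (t := I) fun i hi => ?_).trans_lt (by omega)
    simp only [Finset.mem_filter, Finset.mem_univ, true_and, centered_add_smul,
      hconst i k, hei] at hi
    by_contra hiI
    rw [if_neg hiI] at hi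
    split_ifs at hi <;> linarith
  have hmem' := (hinv _ hε1 (ε * δ) (hsplit ▸ hε2)).1 hmem
  rw [← hsplit, h.mem_tropSpan_iff] at hmem'
  have hval (i) : centered p lam W (vtx p lam W + ε • (e + δ • v)) i =
      centered p lam W (vtx p lam W) (Fin.last d) +
        ε * ((if i ∈ I then -1 else 0) + δ * homog v i) := by
    rw [centered_add_smul, hconst i (Fin.last d), homog_add, hei, homog_smul]
  -- Here `k` and `l` are `j` and the last index in some order. All `|W|` elements of `insert l I`
  -- fall below `k`.
  have hbad (k l : Fin (d + 1)) (hk : k ∉ I) (hl : l ∉ I) (hlt : homog v l < homog v k)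
      (h0 : 0 ≤ homog v k) : False := by
    have hsub : insert l I ⊆ Finset.univ.filter fun i =>
        centered p lam W (vtx p lam W + ε • (e + δ • v)) i <
          centered p lam W (vtx p lam W + ε • (e + δ • v)) k := by
      intro i hi
      simp only [Finset.mem_filter, Finset.mem_univ, true_and, hval, if_neg hk]
      have h0' := mul_nonneg hδ.le h0
      rcases Finset.mem_insert.1 hi with rfl | hiI
      · rw [if_neg hl]
        have := mul_lt_mul_of_pos_left hlt hδ
        gcongr
      · rw [if_pos hiI]
        have : -1 + δ * homog v i < 0 + δ * homog v k := by linarith [hδv i]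
        linarith [mul_lt_mul_of_pos_left this hε]
    have := (Finset.card_le_card hsub).trans_lt (hmem' k)
    rw [Finset.card_insert_of_notMem hl] at this
    omega
  rcases hj.lt_or_gt with hlt | hlt
  · exact hbad (Fin.last d) j.castSucc hlI hjI (by simpa using hlt) (by simp)
  · exact hbad j.castSucc (Fin.last d) hjI hlI (by simpa using hlt) (by simpa using hlt.le)

end minors

end IAP

namespace IAP

/-! ### Vertices and edges of the projected box -/

section polytope

variable {d : ℕ} {A : Matrix (Fin (d + 1)) (Fin (d + 1)) ℝ} {p lam : Fin (d + 1) → ℝ}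

/-- The coordinates of `x` relative to the corner `p` of the cube. -/
def rel (p : Fin (d + 1) → ℝ) (x : Fin d → ℝ) (i : Fin (d + 1)) : ℝ :=
  homog x i - p i

theorem rel_combo (x y : Fin d → ℝ) {a b : ℝ} (hab : a + b = 1) (i : Fin (d + 1)) :
    rel p (a • x + b • y) i = a * rel p x i + b * rel p y i := by
  rw [rel, rel, rel, homog_add, homog_smul, homog_smul]
  linear_combination p i * hab

theorem rel_add_smul (x v : Fin d → ℝ) (t : ℝ) (i : Fin (d + 1)) :
    rel p (x + t • v) i = rel p x i + t * homog v i := by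
  rw [rel, rel, homog_add, homog_smul]
  ring

theorem eq_of_rel_sub_eq {x y : Fin d → ℝ}
    (h : ∀ i j, rel p x i - rel p x j = rel p y i - rel p y j) : x = y := by
  funext i
  have := h i.castSucc (Fin.last d)
  simp only [rel, homog_castSucc, homog_last] at this
  linarith

theorem eq_vtx_iff {W : Finset (Fin (d + 1))} {x : Fin d → ℝ} :
    x = vtx p lam W ↔
      ∀ i j, rel p x i - rel p x j = side lam W i - side lam W j := by
  rw [vtx, eq_dehomog_iff]
  refine forall₂_congr fun i j => ?_
  rw [rel, rel]
  constructor <;> intro h <;> linarith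

theorem rel_vtx (W : Finset (Fin (d + 1))) (i j : Fin (d + 1)) :
    rel p (vtx p lam W) i - rel p (vtx p lam W) j = side lam W i - side lam W j :=
  eq_vtx_iff.1 rfl i j

namespace IsCubeMatrix

theorem mem_alcoved_iff (h : IsCubeMatrix A p lam) {x : Fin d → ℝ} :
    x ∈ alcoved A ↔ ∀ i j, rel p x j - rel p x i ≤ lam j := by
  simp only [alcoved, Set.mem_ofPred_eq, h.apply, rel]
  constructor
  · intro hx i j
    have := (hx i j).1
    have := h.pos j
    split_ifs at * <;> linarith
  · intro hx i j
    have h1 := hx i j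
    have h2 := hx j i
    by_cases hij : i = j
    · subst hij
      simp
    · rw [if_neg hij, if_neg (Ne.symm hij)]
      constructor <;> linarith

theorem side_nonneg (h : IsCubeMatrix A p lam) (W : Finset (Fin (d + 1)))
    (i : Fin (d + 1)) : 0 ≤ side lam W i := by
  rw [side]
  split_ifs
  exacts [(h.pos i).le, le_rfl]

theorem side_le (h : IsCubeMatrix A p lam) (W : Finset (Fin (d + 1)))
    (i : Fin (d + 1)) : side lam W i ≤ lam i := by
  rw [side]
  split_ifs
  exacts [le_rfl, (h.pos i).le]

theorem vtx_mem (h : IsCubeMatrix A p lam) (W : Finset (Fin (d + 1))) :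
    vtx p lam W ∈ alcoved A := by
  rw [h.mem_alcoved_iff]
  intro i j
  rw [rel_vtx]
  linarith [h.side_nonneg W i, h.side_le W j]

/-- A facet inequality that is an equality at a point of an open segment in the polytope is an
equality at the endpoints. -/
theorem tight_of_mem_openSegment (h : IsCubeMatrix A p lam) {x y z : Fin d → ℝ}
    (hx : x ∈ alcoved A) (hy : y ∈ alcoved A) (hz : z ∈ openSegment ℝ x y)
    {i j : Fin (d + 1)} (ht : rel p z j - rel p z i = lam j) :
    rel p x j - rel p x i = lam j := by
  obtain ⟨a, b, ha, hb, hab, rfl⟩ := hz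
  rw [rel_combo x y hab, rel_combo x y hab] at ht
  have hx' := h.mem_alcoved_iff.1 hx i j
  have hy' := h.mem_alcoved_iff.1 hy i j
  refine le_antisymm hx' (le_of_mul_le_mul_left ?_ ha)
  have hlam : a * lam j + b * lam j = lam j := by rw [← add_mul, hab, one_mul]
  linarith [mul_le_mul_of_nonneg_left hy' hb.le]

/-- The inequalities pairing an element of `W` with a non-element are tight, and they determine all
coordinate differences. -/
theorem vtx_mem_extremePoints (h : IsCubeMatrix A p lam) {W : Finset (Fin (d + 1))}
    (hW : W.Nonempty) (hW' : W ≠ Finset.univ) :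
    vtx p lam W ∈ (alcoved A).extremePoints ℝ := by
  refine ⟨h.vtx_mem W, fun x hx y hy hz => eq_vtx_iff.2 ?_⟩
  obtain ⟨k, hk⟩ := hW
  obtain ⟨l, hl⟩ : ∃ l, l ∉ W := by
    by_contra! hcon
    exact hW' (Finset.eq_univ_iff_forall.2 hcon)
  have ht (j) (hj : j ∈ W) (i) (hi : i ∉ W) : rel p x j - rel p x i = lam j := by
    refine h.tight_of_mem_openSegment hx hy hz ?_
    rw [rel_vtx, side_of_mem hj, side_of_notMem hi, sub_zero]
  have hval (i) : rel p x i = rel p x l + side lam W i := by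
    by_cases hi : i ∈ W
    · rw [side_of_mem hi]
      linarith [ht i hi l hl]
    · rw [side_of_notMem hi]
      linarith [ht k hk l hl, ht k hk i hi]
  intro i j
  rw [hval i, hval j]
  ring

/-- Every coordinate is involved in a facet through a given extreme point. -/
theorem exists_tight (h : IsCubeMatrix A p lam) (hd : d ≠ 0) {x : Fin d → ℝ}
    (hx : x ∈ (alcoved A).extremePoints ℝ) (j : Fin (d + 1)) :
    ∃ i, i ≠ j ∧ (rel p x j - rel p x i = lam j ∨ rel p x i - rel p x j = lam i) := by
  by_contra! hcon
  have hmem := h.mem_alcoved_iff.1 hx.1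
  have hpos (i) (hi : i ≠ j) :
      0 < min (lam j - (rel p x j - rel p x i)) (lam i - (rel p x i - rel p x j)) := by
    obtain ⟨h1, h2⟩ := hcon i hi
    exact lt_min (sub_pos.2 ((hmem i j).lt_of_ne h1)) (sub_pos.2 ((hmem j i).lt_of_ne h2))
  -- `ε` is the least slack among the inequalities involving `j`, so coordinate `j` can move by `ε`
  -- both ways.
  obtain ⟨ε, hε, hle⟩ : ∃ ε : ℝ, 0 < ε ∧ ∀ i, i ≠ j →
      ε ≤ lam j - (rel p x j - rel p x i) ∧ ε ≤ lam i - (rel p x i - rel p x j) := by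
    have : Nontrivial (Fin (d + 1)) := Fin.nontrivial_iff_two_le.2 (by omega)
    obtain ⟨i₀, hi₀⟩ := exists_ne j
    obtain ⟨m, hm, hmin⟩ := (Finset.univ.erase j).exists_min_image
      (fun i => min (lam j - (rel p x j - rel p x i)) (lam i - (rel p x i - rel p x j)))
      ⟨i₀, by simpa using hi₀⟩
    exact ⟨_, hpos m (Finset.ne_of_mem_erase hm), fun i hi =>
      le_min_iff.1 (hmin i (Finset.mem_erase.2 ⟨hi, Finset.mem_univ i⟩))⟩
  set v : Fin d → ℝ := dehomog (Pi.single j 1) with hv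
  have hmem' (t : ℝ) (ht : |t| ≤ ε) : x + t • v ∈ alcoved A := by
    rw [h.mem_alcoved_iff]
    intro i k
    rw [rel_add_smul, rel_add_smul, hv, homog_dehomog, homog_dehomog]
    obtain ⟨ht1, ht2⟩ := abs_le.1 ht
    by_cases hi : i = j
    · by_cases hk : k = j
      · subst hi hk
        simpa using (h.pos k).le
      · subst hi
        rw [Pi.single_eq_same, Pi.single_eq_of_ne hk]
        linarith [(hle k hk).2]
    · by_cases hk : k = j
      · subst hk
        rw [Pi.single_eq_same, Pi.single_eq_of_ne hi]
        linarith [(hle i hi).1]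
      · rw [Pi.single_eq_of_ne hi, Pi.single_eq_of_ne hk]
        linarith [hmem i k]
  have hxv := hx.2 (hmem' ε (abs_of_pos hε).le) (hmem' (-ε) (by rw [abs_neg, abs_of_pos hε]))
    ⟨1 / 2, 1 / 2, by norm_num, by norm_num, by norm_num, by module⟩
  have : Nontrivial (Fin (d + 1)) := Fin.nontrivial_iff_two_le.2 (by omega)
  obtain ⟨i, hi⟩ := exists_ne j
  have h1 := rel_add_smul (p := p) x v ε i
  have h2 := rel_add_smul (p := p) x v ε j
  rw [hxv, hv, homog_dehomog, Pi.single_eq_of_ne hi] at h1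
  rw [hxv, hv, homog_dehomog, Pi.single_eq_same] at h2
  linarith

/-- Measured from the least coordinate, every coordinate lies in `[0, lam j]`. A tight inequality
involving `j` forces it to an end of that interval. -/
theorem exists_eq_vtx (h : IsCubeMatrix A p lam) (hd : d ≠ 0) {x : Fin d → ℝ}
    (hx : x ∈ (alcoved A).extremePoints ℝ) :
    ∃ W : Finset (Fin (d + 1)), W.Nonempty ∧ W ≠ Finset.univ ∧ x = vtx p lam W := by
  obtain ⟨m, -, hmin⟩ := Finset.univ.exists_min_image (rel p x) Finset.univ_nonempty
  replace hmin i := hmin i (Finset.mem_univ i)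
  have hmem := h.mem_alcoved_iff.1 hx.1
  have hcase (j) : rel p x j = rel p x m + lam j ∨ rel p x j = rel p x m := by
    obtain ⟨i, -, hi | hi⟩ := h.exists_tight hd hx j
    · left
      linarith [hmem m j, hmin i]
    · right
      linarith [hmem m i, hmin j]
  refine ⟨Finset.univ.filter fun j => rel p x j = rel p x m + lam j, ?_, ?_, ?_⟩
  · obtain ⟨i, -, hi | hi⟩ := h.exists_tight hd hx m
    · linarith [h.pos m, hmin i]
    · exact ⟨i, by simp only [Finset.mem_filter, Finset.mem_univ, true_and]; linarith⟩
  · intro hu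
    have := Finset.eq_univ_iff_forall.1 hu m
    simp only [Finset.mem_filter, Finset.mem_univ, true_and] at this
    linarith [h.pos m]
  · have hval (j) : rel p x j = rel p x m +
        side lam (Finset.univ.filter fun j => rel p x j = rel p x m + lam j) j := by
      simp only [side, Finset.mem_filter, Finset.mem_univ, true_and]
      split_ifs with hj
      · exact hj
      · rw [(hcase j).resolve_left hj, add_zero]
    refine eq_vtx_iff.2 fun i j => ?_
    have hi := hval i
    have hj := hval j
    linarith

theorem vtx_subset (h : IsCubeMatrix A p lam) {W W' : Finset (Fin (d + 1))}
    (hW : W ≠ Finset.univ) (heq : vtx p lam W = vtx p lam W') :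
    W ⊆ W' := by
  intro i hi
  by_contra hi'
  have hdiff := eq_vtx_iff.1 heq
  simp only [rel_vtx] at hdiff
  refine hW (Finset.eq_univ_iff_forall.2 fun j => ?_)
  by_contra hj
  have h1 := hdiff i j
  rw [side_of_mem hi, side_of_notMem hi', side_of_notMem hj] at h1
  linarith [h.pos i, h.side_nonneg W' j]

theorem vtx_injective (h : IsCubeMatrix A p lam) {W W' : Finset (Fin (d + 1))}
    (hW : W.Nonempty ∧ W ≠ Finset.univ) (hW' : W'.Nonempty ∧ W' ≠ Finset.univ)
    (heq : vtx p lam W = vtx p lam W') : W = W' :=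
  (h.vtx_subset hW.2 heq).antisymm (h.vtx_subset hW'.2 heq.symm)

/-- Inequalities pairing `W` with the complement of `insert j W` are tight along the segment. On
their common face only coordinate `j` is free. -/
theorem isExtreme_segment_insert (h : IsCubeMatrix A p lam) {W : Finset (Fin (d + 1))}
    {j : Fin (d + 1)} (hj : j ∉ W) (hW : W.Nonempty) (hW' : insert j W ≠ Finset.univ) :
    IsExtreme ℝ (alcoved A) (segment ℝ (vtx p lam W) (vtx p lam (insert j W))) := by
  have hside (i) (hi : i ≠ j) : side lam (insert j W) i = side lam W i := by
    simp [side, hi]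
  obtain ⟨k, hk⟩ := hW
  obtain ⟨l, hl⟩ : ∃ l, l ∉ insert j W := by
    by_contra! hcon
    exact hW' (Finset.eq_univ_iff_forall.2 hcon)
  refine ⟨?_, ?_⟩
  · rintro _ ⟨a, b, ha, hb, hab, rfl⟩
    refine h.mem_alcoved_iff.2 fun i j' => ?_
    rw [rel_combo _ _ hab, rel_combo _ _ hab]
    have h1 := h.mem_alcoved_iff.1 (h.vtx_mem W) i j'
    have h2 := h.mem_alcoved_iff.1 (h.vtx_mem (insert j W)) i j'
    calc _ = a * (rel p (vtx p lam W) j' - rel p (vtx p lam W) i) +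
          b * (rel p (vtx p lam (insert j W)) j' - rel p (vtx p lam (insert j W)) i) := by ring
      _ ≤ a * lam j' + b * lam j' := by gcongr
      _ = lam j' := by rw [← add_mul, hab, one_mul]
  · intro x hx y hy z hz hzxy
    obtain ⟨a, b, ha, hb, hab, rfl⟩ := hz
    have ht (k) (hk : k ∈ W) (i) (hi : i ∉ insert j W) : rel p x k - rel p x i = lam k := by
      refine h.tight_of_mem_openSegment hx hy hzxy ?_
      have h1 := rel_vtx (p := p) (lam := lam) W k i
      have h2 := rel_vtx (p := p) (lam := lam) (insert j W) k i
      rw [side_of_mem hk, side_of_notMem fun hm => hi (Finset.mem_insert_of_mem hm)] at h1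
      rw [side_of_mem (Finset.mem_insert_of_mem hk), side_of_notMem hi] at h2
      rw [rel_combo _ _ hab, rel_combo _ _ hab]
      linear_combination a * h1 + b * h2 + lam k * hab
    have hmem := h.mem_alcoved_iff.1 hx
    have hlj := h.pos j
    have hj0 : 0 ≤ rel p x j - rel p x l := by linarith [hmem j k, ht k hk l hl]
    -- The position along the edge, read off from the free coordinate `j`.
    set s := (rel p x j - rel p x l) / lam j with hs
    have hsj : s * lam j = rel p x j - rel p x l := div_mul_cancel₀ _ hlj.ne'
    have hs1 : s ≤ 1 := (div_le_one hlj).2 (hmem l j)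
    have hval (i) : rel p x i =
        rel p x l + ((1 - s) * side lam W i + s * side lam (insert j W) i) := by
      by_cases hij : i = j
      · subst hij
        rw [side_of_notMem hj, side_of_mem (Finset.mem_insert_self _ _)]
        linarith
      · rw [hside i hij]
        by_cases hi : i ∈ W
        · rw [side_of_mem hi]
          linarith [ht i hi l hl]
        · rw [side_of_notMem hi]
          have hi' : i ∉ insert j W := by simp [hij, hi]
          linarith [ht k hk l hl, ht k hk i hi']
    refine ⟨1 - s, s, sub_nonneg.2 hs1, div_nonneg hj0 hlj.le, sub_add_cancel 1 s,
      eq_of_rel_sub_eq (p := p) fun i i' => ?_⟩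
    rw [rel_combo _ _ (sub_add_cancel 1 s), rel_combo _ _ (sub_add_cancel 1 s), hval i, hval i']
    linear_combination (1 - s) * rel_vtx (p := p) (lam := lam) W i i' +
      s * rel_vtx (p := p) (lam := lam) (insert j W) i i'

/-- Toggling `j` in both labels swaps their contributions at `j`, so the midpoint is unchanged. A
face containing the midpoint contains the toggled vertices. -/
theorem vtx_symmDiff_mem_segment (h : IsCubeMatrix A p lam) {W W' : Finset (Fin (d + 1))}
    {j : Fin (d + 1)} (hj : j ∈ symmDiff W W')
    (hext : IsExtreme ℝ (alcoved A) (segment ℝ (vtx p lam W) (vtx p lam W'))) :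
    vtx p lam (symmDiff W {j}) ∈ segment ℝ (vtx p lam W) (vtx p lam W') := by
  have hsum (i) : side lam (symmDiff W {j}) i + side lam (symmDiff W' {j}) i =
      side lam W i + side lam W' i := by
    by_cases hij : i = j
    · subst hij
      rcases Finset.mem_symmDiff.1 hj with ⟨h1, h2⟩ | ⟨h1, h2⟩ <;>
        simp [side, Finset.mem_symmDiff, h1, h2]
    · simp [side, Finset.mem_symmDiff, hij]
  have h12 : (1 / 2 : ℝ) + 1 / 2 = 1 := by norm_num
  refine hext.left_mem_of_mem_openSegment (h.vtx_mem _) (h.vtx_mem (symmDiff W' {j}))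
    (z := (1 / 2 : ℝ) • vtx p lam W + (1 / 2 : ℝ) • vtx p lam W')
    ⟨1 / 2, 1 / 2, by norm_num, by norm_num, h12, rfl⟩
    ⟨1 / 2, 1 / 2, by norm_num, by norm_num, h12, eq_of_rel_sub_eq (p := p) fun i i' => ?_⟩
  simp only [rel_combo _ _ h12]
  have h1 := rel_vtx (p := p) (lam := lam) W i i'
  have h2 := rel_vtx (p := p) (lam := lam) W' i i'
  have h3 := rel_vtx (p := p) (lam := lam) (symmDiff W {j}) i i'
  have h4 := rel_vtx (p := p) (lam := lam) (symmDiff W' {j}) i i'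
  linarith [hsum i, hsum i']

end IsCubeMatrix

end polytope

/-! ### Paths through labels, distances and the diameter -/

/-- From one proper subset one can step towards another through proper subsets. -/
theorem Label.exists_step {d : ℕ} (hd : 2 ≤ d) {W W' : Label d} (hne : W ≠ W') :
    ∃ j ∈ symmDiff W.1 W'.1,
      (symmDiff W.1 {j}).Nonempty ∧ symmDiff W.1 {j} ≠ Finset.univ := by
  obtain ⟨W, hW, hWu⟩ := W
  obtain ⟨W', hW', hWu'⟩ := W'
  simp only [ne_eq, Subtype.mk.injEq] at hne ⊢
  have hins (j) (hj : j ∉ W) : symmDiff W {j} = insert j W := by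
    ext i
    by_cases hij : i = j <;> simp [Finset.mem_symmDiff, hij, hj]
  have hera (j) (hj : j ∈ W) : symmDiff W {j} = W.erase j := by
    ext i
    by_cases hij : i = j <;> simp [Finset.mem_symmDiff, hij, hj]
  by_cases hadd : ∃ j, j ∈ W' ∧ j ∉ W ∧ insert j W ≠ Finset.univ
  · obtain ⟨j, hj', hj, hu⟩ := hadd
    exact ⟨j, Finset.mem_symmDiff.2 (Or.inr ⟨hj', hj⟩), by
      rw [hins j hj]
      exact ⟨Finset.insert_nonempty j W, hu⟩⟩
  -- Now every element that could be added would complete `W` to `univ`, so an element of `W`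
  -- outside `W'` is removed instead.
  push Not at hadd
  obtain ⟨k, hk, hk'⟩ : ∃ k, k ∈ W ∧ k ∉ W' := by
    by_contra! hsub
    obtain ⟨j, hj', hj⟩ : ∃ j, j ∈ W' ∧ j ∉ W := by
      by_contra! hsub'
      exact hne (Finset.Subset.antisymm hsub hsub')
    refine hWu' (Finset.univ_subset_iff.1 ?_)
    rw [← hadd j hj' hj]
    exact Finset.insert_subset hj' hsub
  refine ⟨k, Finset.mem_symmDiff.2 (Or.inl ⟨hk, hk'⟩), ?_⟩
  rw [hera k hk]
  refine ⟨?_, fun hu => Finset.notMem_erase k W (hu ▸ Finset.mem_univ k)⟩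
  rw [Finset.nonempty_iff_ne_empty]
  intro hemp
  obtain ⟨j, hj'⟩ := hW'
  have hj : j ∉ W := fun hj => by
    have : j ∈ W.erase k := Finset.mem_erase.2 ⟨fun hjk => hk' (hjk ▸ hj'), hj⟩
    simp [hemp] at this
  -- If the removal left `∅`, then `W = {k}` and `insert j W = univ` would have two elements,
  -- against `d ≥ 2`.
  have hc := congrArg Finset.card (hadd j hj' hj)
  rw [Finset.card_insert_of_notMem hj, ← Finset.card_erase_add_one hk, hemp, Finset.card_univ,
    Fintype.card_fin, Finset.card_empty] at hc
  omega

section labelling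

variable {d : ℕ} {A : Matrix (Fin (d + 1)) (Fin (d + 1)) ℝ} {p lam : Fin (d + 1) → ℝ}

namespace IsCubeMatrix

/-- The labelling of the vertices by proper subsets. -/
noncomputable def label (h : IsCubeMatrix A p lam) (W : Label d) :
    (alcoved A).extremePoints ℝ :=
  ⟨vtx p lam W.1, h.vtx_mem_extremePoints W.2.1 W.2.2⟩

theorem label_injective (h : IsCubeMatrix A p lam) : Function.Injective h.label :=
  fun W W' heq => Subtype.ext (h.vtx_injective W.2 W'.2 (congrArg Subtype.val heq))

theorem label_surjective (h : IsCubeMatrix A p lam) (hd : d ≠ 0) :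
    Function.Surjective h.label := fun ⟨_, hx⟩ => by
  obtain ⟨W, hW, hW', rfl⟩ := h.exists_eq_vtx hd hx
  exact ⟨⟨W, hW, hW'⟩, rfl⟩

theorem isLabelling_label (h : IsCubeMatrix A p lam) (hd : d ≠ 0) :
    IsLabelling A h.label := by
  refine ⟨⟨h.label_injective, h.label_surjective hd⟩, fun W x =>
    ⟨h.eq_vtx_of_isComplexVertex, ?_⟩⟩
  rintro rfl
  exact h.isComplexVertex_vtx W.2.1 W.2.2

/-- Toggling an element of the symmetric difference while staying a proper label gives an extreme
point on the edge. It must be an endpoint, hence the one labelled `W'`. -/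
theorem card_symmDiff_of_adj (h : IsCubeMatrix A p lam) (hd : 2 ≤ d) {W W' : Label d}
    (hadj : (skeleton (alcoved A)).Adj (h.label W) (h.label W')) :
    (symmDiff W.1 W'.1).card = 1 := by
  obtain ⟨j, hj, hprop⟩ := Label.exists_step hd fun heq : W = W' => hadj.1 (heq ▸ rfl)
  have hmem := h.vtx_symmDiff_mem_segment hj hadj.2
  rcases (mem_extremePoints_iff_forall_segment.1
    (h.vtx_mem_extremePoints hprop.1 hprop.2)).2 _ (h.vtx_mem W.1) _ (h.vtx_mem W'.1) hmem
    with heq | heq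
  · have := h.vtx_injective W.2 hprop heq
    have := congrArg (symmDiff W.1) this
    rw [symmDiff_symmDiff_cancel_left, symmDiff_self] at this
    simp at this
  · rw [h.vtx_injective W'.2 hprop heq, symmDiff_symmDiff_cancel_left, Finset.card_singleton]

theorem adj_of_symmDiff_eq (h : IsCubeMatrix A p lam) {W W' : Label d} {j : Fin (d + 1)}
    (hj : symmDiff W.1 {j} = W'.1) :
    (skeleton (alcoved A)).Adj (h.label W) (h.label W') := by
  wlog hjW : j ∉ W.1 generalizing W W'
  · have hj' : symmDiff W'.1 {j} = W.1 := by rw [← hj, symmDiff_symmDiff_cancel_right]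
    refine (this hj' fun hm => ?_).symm
    rw [← hj, Finset.mem_symmDiff] at hm
    simp at hm hjW
    exact hm hjW
  have hins : insert j W.1 = W'.1 := by
    rw [← hj]
    ext i
    by_cases hij : i = j <;> simp [Finset.mem_symmDiff, hij, hjW]
  refine ⟨fun heq => hjW ?_, ?_⟩
  · rw [h.label_injective heq, ← hins]
    exact Finset.mem_insert_self _ _
  · have := h.isExtreme_segment_insert hjW W.2.1 (hins ▸ W'.2.2)
    rwa [hins] at this

theorem edist_label_le (h : IsCubeMatrix A p lam) (hd : 2 ≤ d) (n : ℕ) {W W' : Label d}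
    (hn : (symmDiff W.1 W'.1).card = n) :
    (skeleton (alcoved A)).edist (h.label W) (h.label W') ≤ n := by
  induction n generalizing W with
  | zero =>
    rw [Finset.card_eq_zero, ← Finset.bot_eq_empty, symmDiff_eq_bot] at hn
    rw [Subtype.ext hn, SimpleGraph.edist_self]
    exact bot_le
  | succ n ih =>
    have hne : W ≠ W' := by
      rintro rfl
      simp at hn
    obtain ⟨j, hj, hprop⟩ := Label.exists_step hd hne
    have hadj := h.adj_of_symmDiff_eq (W := W) (W' := ⟨_, hprop⟩) rfl
    refine (SimpleGraph.edist_triangle (v := h.label ⟨_, hprop⟩)).trans ?_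
    rw [SimpleGraph.edist_eq_one_iff_adj.2 hadj, Nat.cast_add, Nat.cast_one, add_comm]
    gcongr
    refine ih ?_
    have hset : symmDiff (symmDiff W.1 {j}) W'.1 = (symmDiff W.1 W'.1).erase j := by
      rw [symmDiff_right_comm]
      ext i
      by_cases hij : i = j
      · subst hij
        simp only [Finset.mem_symmDiff (t := {i}), hj]
        simp
      · simp only [Finset.mem_symmDiff (t := {j}), Finset.mem_singleton, Finset.mem_erase]
        tauto
    change (symmDiff (symmDiff W.1 {j}) W'.1).card = n
    rw [hset, Finset.card_erase_of_mem hj, hn, Nat.add_sub_cancel]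

/-- Each edge changes one element of the label, and symmetric differences satisfy the triangle
inequality. -/
theorem card_symmDiff_le_length (h : IsCubeMatrix A p lam) (hd : 2 ≤ d)
    {u v : (alcoved A).extremePoints ℝ} (w : (skeleton (alcoved A)).Walk u v) :
    ∀ {W W' : Label d}, h.label W = u → h.label W' = v →
      (symmDiff W.1 W'.1).card ≤ w.length := by
  induction w with
  | nil =>
    intro W W' hu hv
    rw [h.label_injective (hu.trans hv.symm)]
    simp
  | @cons a b c hadj w ih =>
    intro W W' hu hv
    obtain ⟨W'', hW''⟩ := h.label_surjective (by omega) b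
    rw [← hu, ← hW''] at hadj
    have h1 := h.card_symmDiff_of_adj hd hadj
    have h2 := ih hW'' hv
    have h3 : symmDiff W.1 W'.1 ⊆ symmDiff W.1 W''.1 ∪ symmDiff W''.1 W'.1 :=
      symmDiff_triangle _ _ _
    have h4 := (Finset.card_le_card h3).trans (Finset.card_union_le _ _)
    rw [SimpleGraph.Walk.length_cons]
    omega

theorem edist_label (h : IsCubeMatrix A p lam) (hd : 2 ≤ d) (W W' : Label d) :
    (skeleton (alcoved A)).edist (h.label W) (h.label W') =
      ((symmDiff W.1 W'.1).card : ℕ∞) := by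
  refine le_antisymm (h.edist_label_le hd _ rfl) (le_iInf fun w => ?_)
  exact_mod_cast h.card_symmDiff_le_length hd w rfl rfl

theorem ediam_skeleton (h : IsCubeMatrix A p lam) (hd : 2 ≤ d) :
    (skeleton (alcoved A)).ediam = ((d + 1 : ℕ) : ℕ∞) := by
  refine le_antisymm (SimpleGraph.ediam_le_of_edist_le fun u v => ?_) ?_
  · obtain ⟨W, rfl⟩ := h.label_surjective (by omega) u
    obtain ⟨W', rfl⟩ := h.label_surjective (by omega) v
    rw [h.edist_label hd]
    exact_mod_cast (Finset.card_le_univ _).trans_eq (Fintype.card_fin _)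
  · have hlast : Fin.last d ≠ 0 := Fin.ne_of_val_ne (by simpa using (by omega : d ≠ 0))
    let W : Label d := ⟨{0}, Finset.singleton_nonempty 0, fun hu =>
      hlast (Finset.mem_singleton.1 (hu ▸ Finset.mem_univ (Fin.last d)))⟩
    let W' : Label d := ⟨{0}ᶜ, ⟨Fin.last d, by simpa using hlast⟩, fun hu => by
      simpa using Finset.eq_univ_iff_forall.1 hu 0⟩
    refine le_of_eq_of_le ?_ (SimpleGraph.edist_le_ediam (u := h.label W) (v := h.label W'))
    rw [h.edist_label hd]
    change _ = ((symmDiff ({0} : Finset (Fin (d + 1))) {0}ᶜ).card : ℕ∞)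
    rw [symmDiff_compl_self, Finset.top_eq_univ, Finset.card_univ, Fintype.card_fin]

end IsCubeMatrix

end labelling

end IAP

theorem corollary5p11 {d : ℕ} (hd : 2 ≤ d) (A : Matrix (Fin (d + 1)) (Fin (d + 1)) ℝ)
    (hA : IAP.IsIsocanted A) :
    (IAP.skeleton (IAP.alcoved A)).ediam = ((d + 1 : ℕ) : ℕ∞) ∧
    ∃ label : IAP.Label d → (IAP.alcoved A).extremePoints ℝ,
      IAP.IsLabelling A label ∧
      ∀ W W' : IAP.Label d,
        (IAP.skeleton (IAP.alcoved A)).edist (label W) (label W') =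
          ((symmDiff W.1 W'.1).card : ℕ∞) := by
  obtain ⟨p, lam, h⟩ := hA.exists_isCubeMatrix
  exact ⟨h.ediam_skeleton hd, h.label, h.isLabelling_label (by omega), h.edist_label hd⟩
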